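/- Let $n\ge 1$. For a homogeneous cubic polynomial $h:\mathbb{R}^{n+1}\to\mathbb{R}$, a point $p$ with $h(p)>0$ is called \emph{hyperbolic} if the negative Hessian $-\partial^2h_p$ has signature $(n,1)$, i.e. $n$ positive squares and one negative square. An \emph{$n$-dimensional CCPSR (closed connected projective special real) manifold} is a non-empty closed connected subset $\mathcal{H}\subset\mathbb{R}^{n+1}$ which, for some homogeneous cubic polynomial $h$, is a relatively open subset of the level set $\{h=1\}$ and consists only of hyperbolic points of $h$. It is a smooth hypersurface transversal to the position vector field $\xi$, and it carries the Riemannian metric $g_{\mathcal{H}}$ (the centro-affine fundamental form) determined by the Gauss equation $$\overline{\nabla}_XY=\nabla_XY+g_{\mathcal{H}}(X,Y)\,\xi ,\qquad X,Y \text{ tangent to }\mathcal{H},$$ where $\overline{\nabla}$ is the canonical flat connection of $\mathbb{R}^{n+1}$ and $\nabla_XY$ is tangent to $\mathcal{H}$; equivalently $g_{\mathcal{H}}=-\tfrac13\,\partial^2h|_{T\mathcal{H}\times T\mathcal{H}}$. \textbf{Corollary.} For every $n\ge 2$ there exist real numbers $l(n),u(n),\widetilde l(n),\widetilde u(n)$,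 depending only on $n$, such that for every $n$-dimensional CCPSR manifold $\mathcal{H}$, at every point of $\mathcal{H}$, the scalar curvature $S_{\mathcal{H}}$ and all sectional curvatures $K_{\mathcal{H}}$ of the Riemannian manifold $(\mathcal{H},g_{\mathcal{H}})$ satisfy $$l(n)\le S_{\mathcal{H}}\le u(n),\qquad \widetilde l(n)\le K_{\mathcal{H}}\le\widetilde u(n).$$ -/

import Mathlib

open scoped ContDiff

/-! ## Closed connected projective special real manifolds -/

/-- The Hessian matrix of the polynomial `h` at the point `p`. -/
noncomputable def hessianMatrix {m : ℕ} (h : MvPolynomial (Fin m) ℝ) (p : Fin m → ℝ) :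
    Matrix (Fin m) (Fin m) ℝ :=
  Matrix.of fun i j => MvPolynomial.eval p (MvPolynomial.pderiv i (MvPolynomial.pderiv j h))

/-- `p` is a hyperbolic point of `h`: `h p > 0` and the negative Hessian of `h` at `p` has
signature `(n, 1)`, i.e. `n` positive squares and one negative square. -/
def IsHyperbolicPoint {n : ℕ} (h : MvPolynomial (Fin (n + 1)) ℝ) (p : Fin (n + 1) → ℝ) : Prop :=
  0 < MvPolynomial.eval p h ∧
    sigPos (-hessianMatrix h p).toQuadraticForm' = n ∧
    sigNeg (-hessianMatrix h p).toQuadraticForm' = 1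

/-- An `n`-dimensional CCPSR manifold: a closed connected subset of `ℝⁿ⁺¹` that is a (relatively)
open subset of the level set `{h = 1}` of a homogeneous cubic polynomial `h` and consists only of
hyperbolic points of `h`. (Such an `h` is automatically a hyperbolic polynomial, since `H` is
non-empty.) -/
def IsCCPSR (n : ℕ) (H : Set (Fin (n + 1) → ℝ)) : Prop :=
  IsClosed H ∧ IsConnected H ∧
    ∃ h : MvPolynomial (Fin (n + 1)) ℝ, h.IsHomogeneous 3 ∧
      (∃ O : Set (Fin (n + 1) → ℝ), IsOpen O ∧ H = O ∩ {p | MvPolynomial.eval p h = 1}) ∧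
      ∀ p ∈ H, IsHyperbolicPoint h p

/-! ## Riemannian curvature in local coordinates -/

/-- The partial derivative `∂ᵢ f` at `u`. -/
noncomputable def partialD {n : ℕ} {F : Type*} [NormedAddCommGroup F] [NormedSpace ℝ F]
    (i : Fin n) (f : (Fin n → ℝ) → F) (u : Fin n → ℝ) : F :=
  fderiv ℝ f u (Pi.single i 1)

/-- Christoffel symbols of the Levi-Civita connection of the metric `∑ gᵢⱼ duⁱ duʲ`:
`christoffel g k i j u = Γᵏᵢⱼ(u)`, where `∇_{∂ᵢ} ∂ⱼ = ∑ₖ Γᵏᵢⱼ ∂ₖ`. -/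
noncomputable def christoffel {n : ℕ} (g : (Fin n → ℝ) → Matrix (Fin n) (Fin n) ℝ)
    (k i j : Fin n) (u : Fin n → ℝ) : ℝ :=
  (1 / 2) * ∑ l, (g u)⁻¹ k l *
    (partialD i (fun v => g v j l) u + partialD j (fun v => g v i l) u
      - partialD l (fun v => g v i j) u)

/-- The Riemann curvature tensor `R(X,Y)Z = ∇_X ∇_Y Z - ∇_Y ∇_X Z - ∇_{[X,Y]} Z` in coordinates:
`R(∂ᵢ,∂ⱼ)∂ₖ = ∑ₗ (riemann g l k i j) ∂ₗ`. -/
noncomputable def riemann {n : ℕ} (g : (Fin n → ℝ) → Matrix (Fin n) (Fin n) ℝ)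
    (l k i j : Fin n) (u : Fin n → ℝ) : ℝ :=
  partialD i (christoffel g l j k) u - partialD j (christoffel g l i k) u
    + ∑ m, (christoffel g l i m u * christoffel g m j k u
      - christoffel g l j m u * christoffel g m i k u)

/-- The Ricci curvature `Ric(∂ⱼ,∂ₖ) = tr (X ↦ R(X,∂ⱼ)∂ₖ)`. -/
noncomputable def ricci {n : ℕ} (g : (Fin n → ℝ) → Matrix (Fin n) (Fin n) ℝ)
    (j k : Fin n) (u : Fin n → ℝ) : ℝ :=
  ∑ i, riemann g i k i j u

/-- The scalar curvature, i.e. the trace of the Ricci curvature with respect to `g`. -/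
noncomputable def scalarCurvature {n : ℕ} (g : (Fin n → ℝ) → Matrix (Fin n) (Fin n) ℝ)
    (u : Fin n → ℝ) : ℝ :=
  ∑ j, ∑ k, (g u)⁻¹ j k * ricci g j k u

/-- The inner product `g_u(a, b)` of two tangent vectors in coordinates. -/
noncomputable def metricInner {n : ℕ} (g : (Fin n → ℝ) → Matrix (Fin n) (Fin n) ℝ)
    (u a b : Fin n → ℝ) : ℝ :=
  ∑ i, ∑ j, g u i j * a i * b j

/-- The tangent vector `R(a,b)c` at `u` in coordinates. -/
noncomputable def riemannVec {n : ℕ} (g : (Fin n → ℝ) → Matrix (Fin n) (Fin n) ℝ)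
    (u a b c : Fin n → ℝ) : Fin n → ℝ :=
  fun l => ∑ i, ∑ j, ∑ k, riemann g l k i j u * a i * b j * c k

/-- The sectional curvature `g(R(a,b)b,a) / (g(a,a) g(b,b) - g(a,b)²)` of the tangent plane spanned
by `a` and `b` at `u`. -/
noncomputable def sectionalCurvature {n : ℕ} (g : (Fin n → ℝ) → Matrix (Fin n) (Fin n) ℝ)
    (u a b : Fin n → ℝ) : ℝ :=
  metricInner g u (riemannVec g u a b b) a /
    (metricInner g u a a * metricInner g u b b - metricInner g u a b ^ 2)

/-! ## Curvatures of a centro-affine hypersurface -/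

/-- `φ` is a smooth immersion of the open set `V ⊆ ℝⁿ` into the hypersurface `H ⊆ ℝⁿ⁺¹`. -/
structure IsLocalParametrization {n : ℕ} (H : Set (Fin (n + 1) → ℝ)) (V : Set (Fin n → ℝ))
    (φ : (Fin n → ℝ) → (Fin (n + 1) → ℝ)) : Prop where
  isOpen : IsOpen V
  smooth : ContDiffOn ℝ ∞ φ V
  mapsTo : Set.MapsTo φ V H
  immersion : ∀ u ∈ V, Function.Injective (fderiv ℝ φ u)

/-- `g` is the coordinate matrix, on `V`, of the centro-affine fundamental form of `φ`. It is given
by the Gauss equation `∂ᵢ∂ⱼφ = ∑ₖ Γᵏᵢⱼ ∂ₖφ + gᵢⱼ φ`, where `Γ` are the coefficients of the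
centro-affine connection. -/
def IsCentroAffineForm {n : ℕ} (V : Set (Fin n → ℝ)) (φ : (Fin n → ℝ) → (Fin (n + 1) → ℝ))
    (g : (Fin n → ℝ) → Matrix (Fin n) (Fin n) ℝ) : Prop :=
  ∀ u ∈ V, ∀ i j, ∃ Γ : Fin n → ℝ,
    partialD i (partialD j φ) u = ∑ k, Γ k • partialD k φ u + g u i j • φ u

/-- `s` is the scalar curvature at `p` of `H` with its centro-affine fundamental form. -/
def IsScalarCurvatureAt {n : ℕ} (H : Set (Fin (n + 1) → ℝ)) (p : Fin (n + 1) → ℝ) (s : ℝ) : Prop :=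
  ∃ (V : Set (Fin n → ℝ)) (φ : (Fin n → ℝ) → (Fin (n + 1) → ℝ))
    (g : (Fin n → ℝ) → Matrix (Fin n) (Fin n) ℝ) (u : Fin n → ℝ),
    IsLocalParametrization H V φ ∧ IsCentroAffineForm V φ g ∧ u ∈ V ∧ φ u = p ∧
      scalarCurvature g u = s

/-- `κ` is the sectional curvature of some tangent plane at `p` of `H` with its centro-affine
fundamental form. -/
def IsSectionalCurvatureAt {n : ℕ} (H : Set (Fin (n + 1) → ℝ)) (p : Fin (n + 1) → ℝ) (κ : ℝ) :
    Prop :=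
  ∃ (V : Set (Fin n → ℝ)) (φ : (Fin n → ℝ) → (Fin (n + 1) → ℝ))
    (g : (Fin n → ℝ) → Matrix (Fin n) (Fin n) ℝ) (u a b : Fin n → ℝ),
    IsLocalParametrization H V φ ∧ IsCentroAffineForm V φ g ∧ u ∈ V ∧ φ u = p ∧
      LinearIndependent ℝ ![a, b] ∧ sectionalCurvature g u a b = κ

set_option maxSynthPendingDepth 3

/-! ## The symmetric trilinear form of a cubic polynomial -/

section CubicForm

variable {m : ℕ}

/-! Write `T` for the polarisation of `h`, so that `h(p) = T(p,p,p)`. Then the tangent space at `p`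
is the kernel of `T(p,p,·)`, and the metric there is `g = -2 T(p,·,·)` (`centroAffineForm_eq`).

The heart is a universal bound on the cubic form on unit tangent vectors (`cubicForm_sq_le`). For
`g(v,v) = 1` and `c = T(v,v,v) > 0`, one has `h(p+tv) = 1 - (3/2)t² + ct³`, whose minimum over `t ≥
0` is `1 - 1/(2c²)`, at `t = 1/c`. If `c² > 1/2`, then `h` is positive on the whole segment up to `t
= 1/c`. Its radial projection to `{h = 1}` is connected and starts in `H`, and `H` is open and
closed in the level set, so the projection stays in `H`. At the endpoint `v` is tangent, but the
second derivative of `h` along `v` is positive there, which hyperbolicity forbids. Hence `c² ≤ 1/2`;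
polarisation extends the bound to `T(a,b,c)` (`apply_sq_le`).

The curvature involves nothing else. The centro-affine connection differs from the Levi-Civita
connection by a tensor `K` with `g(K(a,b),c) = T(a,b,c)`, and the Gauss equation (`sum_mul_riemann`)
gives `g(R(a,b)b,a) = g(K(a,b),K(a,b)) - g(K(a,a),K(b,b)) - (g(a,a)g(b,b) - g(a,b)²)`. The `K`-terms
are at most 32 times the Gram determinant (`abs_apply_apply_le_gram`), so `|sectional curvature| ≤
33`. The scalar curvature is a sum of `n²` such terms over an orthonormal basis. -/

/-- The trilinear form `T(x, y, z) = ⅙ D³h(x, y, z)` of a cubic polynomial `h`. -/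
noncomputable def cubicForm (h : MvPolynomial (Fin m) ℝ) :
    (Fin m → ℝ) →L[ℝ] (Fin m → ℝ) →L[ℝ] (Fin m → ℝ) →L[ℝ] ℝ :=
  ∑ i, ∑ j, ∑ k,
    (MvPolynomial.eval 0 (MvPolynomial.pderiv i (MvPolynomial.pderiv j (MvPolynomial.pderiv k h)))
        / 6) •
      (ContinuousLinearMap.proj (R := ℝ) (φ := fun _ : Fin m => ℝ) i).smulRight
        ((ContinuousLinearMap.proj (R := ℝ) (φ := fun _ : Fin m => ℝ) j).smulRight
          (ContinuousLinearMap.proj (R := ℝ) (φ := fun _ : Fin m => ℝ) k))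

theorem cubicForm_apply (h : MvPolynomial (Fin m) ℝ) (x y z : Fin m → ℝ) :
    cubicForm h x y z = ∑ i, ∑ j, ∑ k,
      (MvPolynomial.eval 0
        (MvPolynomial.pderiv i (MvPolynomial.pderiv j (MvPolynomial.pderiv k h))) / 6) *
        (x i * (y j * z k)) := by
  simp [cubicForm, sum_apply]

/-- The commutator of two derivations is a derivation, and this one kills every variable. -/
theorem pderiv_comm (h : MvPolynomial (Fin m) ℝ) (i j : Fin m) :
    MvPolynomial.pderiv i (MvPolynomial.pderiv j h) =
      MvPolynomial.pderiv j (MvPolynomial.pderiv i h) := by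
  have := MvPolynomial.derivation_eq_zero_of_forall_mem_vars
    (D := ⁅MvPolynomial.pderiv (R := ℝ) i, MvPolynomial.pderiv (R := ℝ) j⁆) (f := h)
    (fun k _ => by
      classical
      simp only [Derivation.commutator_apply, MvPolynomial.pderiv_X, Pi.single_apply]
      split_ifs <;> simp)
  rw [Derivation.commutator_apply] at this
  exact sub_eq_zero.mp this

theorem cubicForm_swap (h : MvPolynomial (Fin m) ℝ) (x y z : Fin m → ℝ) :
    cubicForm h x y z = cubicForm h y x z := by
  rw [cubicForm_apply, cubicForm_apply, Finset.sum_comm]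
  refine Finset.sum_congr rfl fun i _ => Finset.sum_congr rfl fun j _ =>
    Finset.sum_congr rfl fun k _ => ?_
  rw [pderiv_comm]
  ring

theorem cubicForm_swap' (h : MvPolynomial (Fin m) ℝ) (x y z : Fin m → ℝ) :
    cubicForm h x y z = cubicForm h x z y := by
  rw [cubicForm_apply, cubicForm_apply]
  refine Finset.sum_congr rfl fun i _ => ?_
  rw [Finset.sum_comm]
  refine Finset.sum_congr rfl fun j _ => Finset.sum_congr rfl fun k _ => ?_
  rw [pderiv_comm h k j]
  ring

theorem eval_euler {h : MvPolynomial (Fin m) ℝ} {d : ℕ} (hh : h.IsHomogeneous d)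
    (p : Fin m → ℝ) :
    ∑ i, p i * MvPolynomial.eval p (MvPolynomial.pderiv i h) = d * MvPolynomial.eval p h := by
  have := congrArg (MvPolynomial.eval p) hh.sum_X_mul_pderiv
  simpa using this

theorem eval_eq_eval_zero_of_isHomogeneous_zero {h : MvPolynomial (Fin m) ℝ}
    (hh : h.IsHomogeneous 0) (p : Fin m → ℝ) :
    MvPolynomial.eval p h = MvPolynomial.eval 0 h := by
  rw [← MvPolynomial.totalDegree_zero_iff_isHomogeneous,
    MvPolynomial.totalDegree_eq_zero_iff_eq_C] at hh
  rw [hh]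
  simp

theorem eval_pderiv_pderiv {h : MvPolynomial (Fin m) ℝ} (hh : h.IsHomogeneous 3)
    (p : Fin m → ℝ) (j k : Fin m) :
    MvPolynomial.eval p (MvPolynomial.pderiv j (MvPolynomial.pderiv k h)) =
      ∑ i, MvPolynomial.eval 0
        (MvPolynomial.pderiv i (MvPolynomial.pderiv j (MvPolynomial.pderiv k h))) * p i := by
  have h1 : (MvPolynomial.pderiv j (MvPolynomial.pderiv k h)).IsHomogeneous 1 := hh.pderiv.pderiv
  have h2 := eval_euler h1 p
  rw [Nat.cast_one, one_mul] at h2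
  rw [← h2]
  refine Finset.sum_congr rfl fun i _ => ?_
  rw [eval_eq_eval_zero_of_isHomogeneous_zero h1.pderiv, mul_comm]

theorem cubicForm_apply_eq_hessian {h : MvPolynomial (Fin m) ℝ} (hh : h.IsHomogeneous 3)
    (p y z : Fin m → ℝ) :
    6 * cubicForm h p y z = ∑ j, ∑ k, hessianMatrix h p j k * (y j * z k) := by
  rw [cubicForm_apply, Finset.sum_comm, Finset.mul_sum]
  refine Finset.sum_congr rfl fun j _ => ?_
  rw [Finset.sum_comm, Finset.mul_sum]
  refine Finset.sum_congr rfl fun k _ => ?_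
  rw [hessianMatrix, Matrix.of_apply, eval_pderiv_pderiv hh, Finset.mul_sum, Finset.sum_mul]
  refine Finset.sum_congr rfl fun i _ => ?_
  ring

theorem cubicForm_self {h : MvPolynomial (Fin m) ℝ} (hh : h.IsHomogeneous 3) (p : Fin m → ℝ) :
    cubicForm h p p p = MvPolynomial.eval p h := by
  have h1 := cubicForm_apply_eq_hessian hh p p p
  have h2 : ∀ j, ∑ k, hessianMatrix h p k j * (p k * p j) =
      2 * (p j * MvPolynomial.eval p (MvPolynomial.pderiv j h)) := by
    intro j
    have := eval_euler (hh.pderiv (i := j)) p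
    norm_num at this
    rw [mul_left_comm, ← this, Finset.mul_sum]
    refine Finset.sum_congr rfl fun k _ => ?_
    rw [hessianMatrix, Matrix.of_apply]
    ring
  rw [Finset.sum_comm, Finset.sum_congr rfl fun j _ => h2 j, ← Finset.mul_sum,
    eval_euler hh] at h1
  push_cast at h1
  linarith

theorem neg_hessianMatrix_toQuadraticForm' {h : MvPolynomial (Fin m) ℝ} (hh : h.IsHomogeneous 3)
    (p y : Fin m → ℝ) :
    (-hessianMatrix h p).toQuadraticForm' y = -(6 * cubicForm h p y y) := by
  rw [cubicForm_apply_eq_hessian hh]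
  simp [Matrix.toQuadraticForm', Matrix.toLinearMap₂'_apply, mul_comm, mul_left_comm]

end CubicForm

/-! ## Hyperbolic points -/

/-- This is positive definiteness of the metric. Otherwise the negative Hessian, diagonal on the
plane spanned by `q` and `v`, would be nonpositive there. A nonpositive plane leaves room for at
most `n - 1` positive squares in dimension `n + 1`. -/
theorem IsHyperbolicPoint.cubicForm_neg {n : ℕ} {h : MvPolynomial (Fin (n + 1)) ℝ}
    (hh : h.IsHomogeneous 3) {q v : Fin (n + 1) → ℝ} (hq : IsHyperbolicPoint h q) (hv : v ≠ 0)
    (hqv : cubicForm h q q v = 0) : cubicForm h q v v < 0 := by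
  by_contra! hcon
  have hpos : 0 < cubicForm h q q q := by rw [cubicForm_self hh]; exact hq.1
  have hli : LinearIndependent ℝ ![q, v] := by
    rw [LinearIndependent.pair_iff]
    intro s t hst
    have h1 := congrArg (cubicForm h q q) hst
    simp only [map_add, map_smul, hqv, map_zero, smul_eq_mul, mul_zero, add_zero] at h1
    have hs : s = 0 := by
      rcases mul_eq_zero.mp h1 with h1 | h1
      · exact h1
      · exact absurd h1 hpos.ne'
    refine ⟨hs, ?_⟩
    rw [hs, zero_smul, zero_add] at hst
    exact (smul_eq_zero.mp hst).resolve_right hv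
  have hrank := finrank_span_eq_card hli
  have hle := QuadraticForm.sigPos_add_finrank_le_of_nonpos
    (Q := (-hessianMatrix h q).toQuadraticForm') (V := Submodule.span ℝ (Set.range ![q, v])) ?_
  · rw [hrank, hq.2.1] at hle
    simp at hle
  · intro x hx
    rw [Matrix.range_cons, Matrix.range_cons, Matrix.range_empty, Set.union_empty] at hx
    obtain ⟨a, b, rfl⟩ := Submodule.mem_span_pair.mp hx
    rw [neg_hessianMatrix_toQuadraticForm' hh]
    simp only [map_add, map_smul, add_apply, smul_apply,
      smul_eq_mul, hqv, cubicForm_swap' h q v q]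
    nlinarith [mul_nonneg (sq_nonneg a) hpos.le, mul_nonneg (sq_nonneg b) hcon]

/-! ## The cubic form on the tangent spaces of a CCPSR manifold -/

/-- `H` is open and closed in `S`, so a connected subset of `S` that meets `H` cannot leave it. This
is the only place where closedness of `H` acts. -/
theorem IsPreconnected.subset_of_isClosed_of_eq_inter {X : Type*} [TopologicalSpace X]
    {H O S K : Set X} (hK : IsPreconnected K) (hH : IsClosed H) (hO : IsOpen O) (hHO : H = O ∩ S)
    (hKS : K ⊆ S) (hne : (K ∩ H).Nonempty) : K ⊆ H := by
  have h1 : K ⊆ O ∪ Hᶜ := by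
    intro x hx
    by_cases hxH : x ∈ H
    · left
      rw [hHO] at hxH
      exact hxH.1
    · exact Or.inr hxH
  have h2 : K ∩ (O ∩ Hᶜ) = ∅ := by
    rw [Set.eq_empty_iff_forall_notMem]
    rintro x ⟨hx, hxO, hxH⟩
    apply hxH
    rw [hHO]
    exact ⟨hxO, hKS hx⟩
  rcases isPreconnected_iff_subset_of_disjoint.mp hK O Hᶜ hO hH.isOpen_compl h1 h2 with h | h
  · intro x hx
    rw [hHO]
    exact ⟨h hx, hKS hx⟩
  · obtain ⟨x, hxK, hxH⟩ := hne
    exact absurd hxH (h hxK)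

section

variable {n : ℕ} {H O : Set (Fin (n + 1) → ℝ)} {h : MvPolynomial (Fin (n + 1)) ℝ}
  {p v : Fin (n + 1) → ℝ}

/-- The normalisation `-1/2` says that `v` is a unit vector for `-2 T(p,·,·)`. -/
theorem eval_add_smul (hh : h.IsHomogeneous 3) (hp : MvPolynomial.eval p h = 1)
    (hv : cubicForm h p p v = 0) (hv1 : cubicForm h p v v = -(1 / 2)) (t : ℝ) :
    MvPolynomial.eval (p + t • v) h = 1 - 3 / 2 * t ^ 2 + cubicForm h v v v * t ^ 3 := by
  rw [← cubicForm_self hh] at hp ⊢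
  have hv2 : cubicForm h v v p = -(1 / 2) := by rw [cubicForm_swap', cubicForm_swap, hv1]
  simp only [map_add, map_smul, add_apply, smul_apply, smul_eq_mul, cubicForm_swap h v p,
    cubicForm_swap' h p v p, hp, hv, hv1, hv2]
  ring

/-- If `c² > 1/2`, the path over `[0, 1/c]` reaches the critical point `t = 1/c` of `h(p+tv)` inside
`H`; that point is a minimum in a tangent direction, whereas hyperbolicity requires a strict
maximum. -/
theorem cubicForm_sq_le_half_of_pos (hcl : IsClosed H) (hh : h.IsHomogeneous 3) (hO : IsOpen O)
    (hHO : H = O ∩ {p | MvPolynomial.eval p h = 1}) (hyp : ∀ p ∈ H, IsHyperbolicPoint h p)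
    (hp : p ∈ H) (hv : cubicForm h p p v = 0) (hv1 : cubicForm h p v v = -(1 / 2))
    (hc : 0 < cubicForm h v v v) : cubicForm h v v v ^ 2 ≤ 1 / 2 := by
  by_contra! hcon
  have hp1 : MvPolynomial.eval p h = 1 := by
    rw [hHO] at hp
    exact hp.2
  have hf := eval_add_smul hh hp1 hv hv1
  set c := cubicForm h v v v with hcdef
  have hfpos : ∀ t ∈ Set.Icc (0 : ℝ) c⁻¹, 0 < MvPolynomial.eval (p + t • v) h := by
    intro t ht
    have hct : 0 ≤ c * t := mul_nonneg hc.le ht.1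
    -- The double root at `t = 1/c` isolates the minimum `c² - 1/2`, positive by assumption.
    have key : c ^ 2 * MvPolynomial.eval (p + t • v) h =
        (c ^ 2 - 1 / 2) + 1 / 2 * ((1 - c * t) ^ 2 * (1 + 2 * (c * t))) := by
      rw [hf]
      ring
    have h3 : 0 < c ^ 2 * MvPolynomial.eval (p + t • v) h := by
      rw [key]
      have : 0 ≤ (1 - c * t) ^ 2 * (1 + 2 * (c * t)) := by positivity
      linarith
    exact pos_of_mul_pos_right h3 (sq_nonneg c)
  have hcont : Continuous fun t : ℝ => MvPolynomial.eval (p + t • v) h := by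
    simp only [hf]
    fun_prop
  -- Radial projection to `{h = 1}`; the exponent is `-1/3` because `h` has degree 3.
  let γ : ℝ → Fin (n + 1) → ℝ :=
    fun t => (MvPolynomial.eval (p + t • v) h ^ (-(1 / 3) : ℝ)) • (p + t • v)
  have hγ : ContinuousOn γ (Set.Icc 0 c⁻¹) := by
    refine ContinuousOn.smul (hcont.continuousOn.rpow_const fun t ht => Or.inl (hfpos t ht).ne') ?_
    fun_prop
  have hγH : γ '' Set.Icc 0 c⁻¹ ⊆ H := by
    refine (isPreconnected_Icc.image γ hγ).subset_of_isClosed_of_eq_inter hcl hO hHO ?_ ?_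
    · rintro _ ⟨t, ht, rfl⟩
      have h0 := hfpos t ht
      change MvPolynomial.eval (γ t) h = 1
      have h1 : MvPolynomial.eval (γ t) h = (MvPolynomial.eval (p + t • v) h ^ (-(1 / 3) : ℝ)) ^ 3 *
          MvPolynomial.eval (p + t • v) h := by
        simp only [γ]
        generalize MvPolynomial.eval (p + t • v) h ^ (-(1 / 3) : ℝ) = r
        simp only [← cubicForm_self hh, map_smul, smul_apply, smul_eq_mul]
        ring
      rw [h1, ← Real.rpow_natCast, ← Real.rpow_mul h0.le]
      norm_num
      rw [Real.rpow_neg_one, inv_mul_cancel₀ h0.ne']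
    · refine ⟨γ 0, ⟨0, ⟨le_rfl, by positivity⟩, rfl⟩, ?_⟩
      simpa [γ, hp1] using hp
  have hend : c⁻¹ ∈ Set.Icc 0 c⁻¹ := ⟨by positivity, le_rfl⟩
  have hq := hyp _ (hγH ⟨c⁻¹, hend, rfl⟩)
  have hr : 0 < MvPolynomial.eval (p + c⁻¹ • v) h ^ (-(1 / 3) : ℝ) :=
    Real.rpow_pos_of_pos (hfpos _ hend) _
  simp only [γ] at hq
  generalize MvPolynomial.eval (p + c⁻¹ • v) h ^ (-(1 / 3) : ℝ) = r at hq hr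
  have hcc : c⁻¹ * c = 1 := inv_mul_cancel₀ hc.ne'
  have hv0 : v ≠ 0 := by
    rintro rfl
    simp at hv1
  -- With `q = r(p + v/c)`: `T(q,q,v) = r²(-1/c + 1/c) = 0`, while `T(q,v,v) = r(-1/2 + 1) > 0`.
  have hneg := hq.cubicForm_neg hh hv0 (by
    simp only [map_add, map_smul, add_apply, smul_apply, smul_eq_mul, cubicForm_swap h v p,
      hv, hv1, ← hcdef]
    linear_combination (r ^ 2 * c⁻¹) * hcc)
  simp only [map_add, map_smul, add_apply, smul_apply, smul_eq_mul, hv1, ← hcdef, hcc] at hneg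
  linarith

theorem cubicForm_sq_le_half (hcl : IsClosed H) (hh : h.IsHomogeneous 3) (hO : IsOpen O)
    (hHO : H = O ∩ {p | MvPolynomial.eval p h = 1}) (hyp : ∀ p ∈ H, IsHyperbolicPoint h p)
    (hp : p ∈ H) (hv : cubicForm h p p v = 0) (hv1 : cubicForm h p v v = -(1 / 2)) :
    cubicForm h v v v ^ 2 ≤ 1 / 2 := by
  rcases lt_trichotomy (cubicForm h v v v) 0 with hc | hc | hc
  · have := cubicForm_sq_le_half_of_pos (v := -v) hcl hh hO hHO hyp hp (by simp [hv])
      (by simp [hv1]) (by simpa using hc)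
    simpa using this
  · rw [hc]
    norm_num
  · exact cubicForm_sq_le_half_of_pos hcl hh hO hHO hyp hp hv hv1 hc

/-- On tangent vectors, the cubic form is bounded in terms of the centro-affine fundamental form
`-2 T(p, v, v)`. -/
theorem cubicForm_sq_le (hcl : IsClosed H) (hh : h.IsHomogeneous 3) (hO : IsOpen O)
    (hHO : H = O ∩ {p | MvPolynomial.eval p h = 1}) (hyp : ∀ p ∈ H, IsHyperbolicPoint h p)
    (hp : p ∈ H) (hv : cubicForm h p p v = 0) :
    cubicForm h v v v ^ 2 ≤ (-2 * cubicForm h p v v) ^ 3 / 2 := by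
  rcases eq_or_ne v 0 with rfl | hv0
  · simp
  have hneg := (hyp p hp).cubicForm_neg hh hv0 hv
  set N := -2 * cubicForm h p v v with hN
  have hNpos : 0 < N := by linarith
  have hr : 0 < √N := Real.sqrt_pos.mpr hNpos
  have hsq : √N ^ 2 = N := Real.sq_sqrt hNpos.le
  -- Rescale to a unit vector; the squared cubic term has degree 6, hence the factor `N³`.
  have := cubicForm_sq_le_half (v := (√N)⁻¹ • v) hcl hh hO hHO hyp hp (by simp [hv]) (by
    simp only [map_smul, smul_apply, smul_eq_mul]
    field_simp
    rw [hsq]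
    linarith)
  simp only [map_smul, smul_apply, smul_eq_mul] at this
  have h6 : √N ^ 6 = N ^ 3 := by
    calc √N ^ 6 = (√N ^ 2) ^ 3 := by ring
      _ = N ^ 3 := by rw [hsq]
  field_simp at this
  rw [h6] at this
  linarith

end

/-! ## Bounds for algebraic curvature expressions -/

section AlgebraicBounds

variable {F : Type*} [AddCommGroup F] [Module ℝ F] {B : LinearMap.BilinForm ℝ F}
  {k : F →ₗ[ℝ] F →ₗ[ℝ] F}

theorem bilinForm_sq_le (hpos : ∀ x, 0 ≤ B x x) (hsymm : ∀ x y, B x y = B y x) (x y : F) :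
    B x y ^ 2 ≤ B x x * B y y := by
  have := LinearMap.BilinForm.apply_mul_apply_le_of_forall_zero_le B hpos x y
  rwa [hsymm y x, ← sq] at this

theorem bilinForm_add_add_le (hpos : ∀ x, 0 ≤ B x x) (hsymm : ∀ x y, B x y = B y x) {a b c : F}
    (ha : B a a = 1) (hb : B b b = 1) (hc : B c c = 1) : B (a + b + c) (a + b + c) ≤ 9 := by
  have h1 := hpos (a - b)
  have h2 := hpos (b - c)
  have h3 := hpos (a - c)
  simp only [map_add, map_sub, LinearMap.add_apply, LinearMap.sub_apply, hsymm b a, hsymm c b,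
    hsymm c a, ha, hb, hc] at *
  linarith

theorem abs_apply_self_le (hpos : ∀ x, 0 ≤ B x x)
    (hk : ∀ v, B (k v v) v ^ 2 ≤ B v v ^ 3 / 2) {x : F} (hx : B x x ≤ 9) :
    |B (k x x) x| ≤ 20 := by
  -- `9³/2 = 364.5 ≤ 20²`.
  refine abs_le_of_sq_le_sq ?_ (by norm_num)
  have h1 := hk x
  have h2 : B x x ^ 3 ≤ 9 ^ 3 := pow_le_pow_left₀ (hpos x) hx 3
  norm_num at h2 ⊢
  linarith

/-- Polarisation: with `f(x) = B(k(x,x),x)`, `f(a+b+c) - f(a+b-c) - f(a-b+c) + f(a-b-c) = 24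
B(k(a,b),c)`. Each argument has squared length at most 9, so each value is at most 20 in size, and
`80/24 < 4`. -/
theorem abs_apply_le_of_unit (hpos : ∀ x, 0 ≤ B x x) (hsymm : ∀ x y, B x y = B y x)
    (hk1 : ∀ a b, k a b = k b a) (hk2 : ∀ a b c, B (k a b) c = B (k a c) b)
    (hk : ∀ v, B (k v v) v ^ 2 ≤ B v v ^ 3 / 2) {a b c : F}
    (ha : B a a = 1) (hb : B b b = 1) (hc : B c c = 1) : |B (k a b) c| ≤ 4 := by
  have hneg : ∀ x, B (-x) (-x) = B x x := fun x => by simp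
  have e1 := abs_le.mp (abs_apply_self_le hpos hk (bilinForm_add_add_le hpos hsymm ha hb hc))
  have e2 := abs_le.mp (abs_apply_self_le hpos hk
    (bilinForm_add_add_le hpos hsymm ha hb ((hneg c).trans hc)))
  have e3 := abs_le.mp (abs_apply_self_le hpos hk
    (bilinForm_add_add_le hpos hsymm ha ((hneg b).trans hb) hc))
  have e4 := abs_le.mp (abs_apply_self_le hpos hk
    (bilinForm_add_add_le hpos hsymm ha ((hneg b).trans hb) ((hneg c).trans hc)))
  have s1 : B (k a c) b = B (k a b) c := (hk2 a b c).symm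
  have s2 : B (k b c) a = B (k a b) c := by rw [hk2 b c a, hk1 b a]
  simp only [map_add, map_neg, LinearMap.add_apply, LinearMap.neg_apply, hk1 b a, hk1 c a, hk1 c b,
    s1, s2, hk2 a a b, hk2 a a c, hk2 b b a, hk2 b b c, hk2 c c a, hk2 c c b] at e1 e2 e3 e4
  rw [abs_le]
  constructor <;> linarith [e1.1, e1.2, e2.1, e2.2, e3.1, e3.2, e4.1, e4.2]

theorem apply_sq_le (hpos : ∀ x, x ≠ 0 → 0 < B x x) (hsymm : ∀ x y, B x y = B y x)
    (hk1 : ∀ a b, k a b = k b a) (hk2 : ∀ a b c, B (k a b) c = B (k a c) b)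
    (hk : ∀ v, B (k v v) v ^ 2 ≤ B v v ^ 3 / 2) (a b c : F) :
    B (k a b) c ^ 2 ≤ 16 * (B a a * B b b * B c c) := by
  rcases eq_or_ne a 0 with rfl | ha
  · simp
  rcases eq_or_ne b 0 with rfl | hb
  · simp
  rcases eq_or_ne c 0 with rfl | hc
  · simp
  have hpos' : ∀ x, 0 ≤ B x x := fun x => by
    rcases eq_or_ne x 0 with rfl | hx
    · simp
    · exact (hpos x hx).le
  have hunit : ∀ x, x ≠ 0 → B ((√(B x x))⁻¹ • x) ((√(B x x))⁻¹ • x) = 1 := fun x hx => by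
    have h0 := hpos x hx
    have hr : 0 < √(B x x) := Real.sqrt_pos.mpr h0
    have hsq := Real.sq_sqrt h0.le
    simp only [map_smul, LinearMap.smul_apply, smul_eq_mul]
    field_simp
    exact hsq.symm
  have key := abs_apply_le_of_unit hpos' hsymm hk1 hk2 hk (hunit a ha) (hunit b hb) (hunit c hc)
  have hra := Real.sqrt_pos.mpr (hpos a ha)
  have hrb := Real.sqrt_pos.mpr (hpos b hb)
  have hrc := Real.sqrt_pos.mpr (hpos c hc)
  have key2 := sq_le_sq' (neg_le_of_abs_le key) (le_of_abs_le key)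
  simp only [map_smul, LinearMap.smul_apply, smul_eq_mul, mul_pow, inv_pow,
    Real.sq_sqrt (hpos' _)] at key2
  have h0a := hpos a ha
  have h0b := hpos b hb
  have h0c := hpos c hc
  field_simp at key2
  linarith

/-- Take the third argument of the trilinear bound to be `k a b` and cancel one factor. -/
theorem apply_apply_le (hpos : ∀ x, x ≠ 0 → 0 < B x x) (hsymm : ∀ x y, B x y = B y x)
    (hk1 : ∀ a b, k a b = k b a) (hk2 : ∀ a b c, B (k a b) c = B (k a c) b)
    (hk : ∀ v, B (k v v) v ^ 2 ≤ B v v ^ 3 / 2) (a b : F) :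
    B (k a b) (k a b) ≤ 16 * (B a a * B b b) := by
  have h1 := apply_sq_le hpos hsymm hk1 hk2 hk a b (k a b)
  rcases eq_or_ne (k a b) 0 with h0 | h0
  · have hpos' : ∀ x, 0 ≤ B x x := fun x => by
      rcases eq_or_ne x 0 with rfl | hx
      · simp
      · exact (hpos x hx).le
    rw [h0]
    simpa using mul_nonneg (hpos' a) (hpos' b)
  · have := hpos _ h0
    rw [← mul_assoc, sq] at h1
    exact le_of_mul_le_mul_right h1 this

theorem abs_apply_apply_le (hpos : ∀ x, x ≠ 0 → 0 < B x x) (hsymm : ∀ x y, B x y = B y x)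
    (hk1 : ∀ a b, k a b = k b a) (hk2 : ∀ a b c, B (k a b) c = B (k a c) b)
    (hk : ∀ v, B (k v v) v ^ 2 ≤ B v v ^ 3 / 2) (a b : F) :
    |B (k a b) (k a b) - B (k a a) (k b b)| ≤ 32 * (B a a * B b b) := by
  have hpos' : ∀ x, 0 ≤ B x x := fun x => by
    rcases eq_or_ne x 0 with rfl | hx
    · simp
    · exact (hpos x hx).le
  have hk' := apply_apply_le hpos hsymm hk1 hk2 hk
  have h0 : 0 ≤ B a a * B b b := mul_nonneg (hpos' a) (hpos' b)
  have h1 : |B (k a a) (k b b)| ≤ 16 * (B a a * B b b) := by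
    refine abs_le_of_sq_le_sq ?_ (by positivity)
    calc B (k a a) (k b b) ^ 2 ≤ B (k a a) (k a a) * B (k b b) (k b b) :=
          bilinForm_sq_le hpos' hsymm _ _
      _ ≤ (16 * (B a a * B a a)) * (16 * (B b b * B b b)) :=
          mul_le_mul (hk' a a) (hk' b b) (hpos' _)
            (mul_nonneg (by norm_num) (mul_nonneg (hpos' a) (hpos' a)))
      _ = (16 * (B a a * B b b)) ^ 2 := by ring
  have h2 := hk' a b
  have h3 := hpos' (k a b)
  rw [abs_le] at *
  constructor <;> linarith [h1.1, h1.2]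

/-- The left side is unchanged when a multiple of `a` is added to `b`. Making `b` orthogonal to `a`
turns the product of squared lengths into the Gram determinant. -/
theorem abs_apply_apply_le_gram (hpos : ∀ x, x ≠ 0 → 0 < B x x) (hsymm : ∀ x y, B x y = B y x)
    (hk1 : ∀ a b, k a b = k b a) (hk2 : ∀ a b c, B (k a b) c = B (k a c) b)
    (hk : ∀ v, B (k v v) v ^ 2 ≤ B v v ^ 3 / 2) (a b : F) :
    |B (k a b) (k a b) - B (k a a) (k b b)| ≤ 32 * (B a a * B b b - B a b ^ 2) := by
  rcases eq_or_ne a 0 with rfl | ha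
  · simp
  have h0 := hpos a ha
  have h1 := abs_apply_apply_le hpos hsymm hk1 hk2 hk a (b - (B a b / B a a) • a)
  convert h1 using 2
  · simp only [map_sub, map_smul, LinearMap.sub_apply, LinearMap.smul_apply, smul_eq_mul, hk1 b a,
      hsymm (k a b) (k a a)]
    ring
  · simp only [map_sub, map_smul, LinearMap.sub_apply, LinearMap.smul_apply, smul_eq_mul, hsymm b a]
    field_simp
    ring

end AlgebraicBounds

/-! ## Partial derivatives -/

section PartialDerivatives

variable {n : ℕ} {E F : Type*} [NormedAddCommGroup E] [NormedSpace ℝ E]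
  [NormedAddCommGroup F] [NormedSpace ℝ F] {V : Set (Fin n → ℝ)} {u : Fin n → ℝ}

theorem partialD_congr {f f' : (Fin n → ℝ) → F} (hV : IsOpen V) (hu : u ∈ V)
    (hff : ∀ v ∈ V, f v = f' v) (i : Fin n) : partialD i f u = partialD i f' u := by
  have : f =ᶠ[nhds u] f' := Filter.eventuallyEq_of_mem (hV.mem_nhds hu) hff
  rw [partialD, partialD, this.fderiv_eq]

theorem ContDiffOn.differentiableAt_of_isOpen {f : (Fin n → ℝ) → F} (hf : ContDiffOn ℝ ∞ f V)
    (hV : IsOpen V) (hu : u ∈ V) : DifferentiableAt ℝ f u :=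
  (hf.contDiffAt (hV.mem_nhds hu)).differentiableAt (by simp)

theorem ContDiffOn.partialD {f : (Fin n → ℝ) → F} (hf : ContDiffOn ℝ ∞ f V) (hV : IsOpen V)
    (i : Fin n) : ContDiffOn ℝ ∞ (_root_.partialD i f) V :=
  (hf.fderiv_of_isOpen hV (by simp)).clm_apply contDiffOn_const

theorem partialD_comm {f : (Fin n → ℝ) → F} (hf : ContDiffOn ℝ ∞ f V) (hV : IsOpen V)
    (hu : u ∈ V) (i j : Fin n) :
    partialD i (partialD j f) u = partialD j (partialD i f) u := by
  have h1 := hf.contDiffAt (hV.mem_nhds hu)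
  have h2 : IsSymmSndFDerivAt ℝ f u := h1.isSymmSndFDerivAt (by
    simp only [minSmoothness_of_isRCLikeNormedField]
    exact WithTop.coe_le_coe.2 le_top)
  have h3 : DifferentiableAt ℝ (fderiv ℝ f) u :=
    (hf.fderiv_of_isOpen hV (m := ∞) (by simp)).differentiableAt_of_isOpen hV hu
  have h4 : ∀ a b : Fin n, partialD a (partialD b f) u =
      fderiv ℝ (fderiv ℝ f) u (Pi.single a 1) (Pi.single b 1) := by
    intro a b
    change fderiv ℝ (fun v => fderiv ℝ f v (Pi.single b 1)) u (Pi.single a 1) = _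
    rw [fderiv_clm_apply h3 (differentiableAt_const _)]
    simp
  rw [h4, h4, h2]

theorem partialD_trilinear (T : E →L[ℝ] E →L[ℝ] E →L[ℝ] ℝ) {X Y Z : (Fin n → ℝ) → E}
    (hX : DifferentiableAt ℝ X u) (hY : DifferentiableAt ℝ Y u) (hZ : DifferentiableAt ℝ Z u)
    (i : Fin n) :
    partialD i (fun v => T (X v) (Y v) (Z v)) u =
      T (partialD i X u) (Y u) (Z u) + T (X u) (partialD i Y u) (Z u)
        + T (X u) (Y u) (partialD i Z u) := by
  have h1 : HasFDerivAt (fun v => T (X v)) (T.comp (fderiv ℝ X u)) u :=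
    T.hasFDerivAt.comp u hX.hasFDerivAt
  have h2 := (h1.clm_apply hY.hasFDerivAt).clm_apply hZ.hasFDerivAt
  rw [partialD, h2.fderiv]
  simp [partialD]
  ring

theorem ContDiffOn.trilinear (T : E →L[ℝ] E →L[ℝ] E →L[ℝ] ℝ) {X Y Z : (Fin n → ℝ) → E}
    (hX : ContDiffOn ℝ ∞ X V) (hY : ContDiffOn ℝ ∞ Y V) (hZ : ContDiffOn ℝ ∞ Z V) :
    ContDiffOn ℝ ∞ (fun v => T (X v) (Y v) (Z v)) V :=
  ((T.contDiff.comp_contDiffOn hX).clm_apply hY).clm_apply hZ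

theorem partialD_add {f f' : (Fin n → ℝ) → F} (hf : DifferentiableAt ℝ f u)
    (hf' : DifferentiableAt ℝ f' u) (i : Fin n) :
    partialD i (fun v => f v + f' v) u = partialD i f u + partialD i f' u := by
  rw [partialD, fderiv_fun_add hf hf']
  rfl

theorem partialD_const_mul {f : (Fin n → ℝ) → ℝ} (hf : DifferentiableAt ℝ f u) (c : ℝ)
    (i : Fin n) : partialD i (fun v => c * f v) u = c * partialD i f u := by
  rw [partialD, fderiv_const_mul hf]
  rfl

theorem partialD_mul {f f' : (Fin n → ℝ) → ℝ} (hf : DifferentiableAt ℝ f u)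
    (hf' : DifferentiableAt ℝ f' u) (i : Fin n) :
    partialD i (fun v => f v * f' v) u = partialD i f u * f' u + f u * partialD i f' u := by
  rw [partialD, fderiv_fun_mul hf hf']
  simp [partialD]
  ring

theorem partialD_sum {ι : Type*} [Fintype ι] {f : ι → (Fin n → ℝ) → F}
    (hf : ∀ a, DifferentiableAt ℝ (f a) u) (i : Fin n) :
    partialD i (fun v => ∑ a, f a v) u = ∑ a, partialD i (f a) u := by
  rw [partialD, fderiv_fun_sum fun a _ => hf a]
  simp [partialD]

theorem partialD_const (c : F) (i : Fin n) : partialD i (fun _ => c) u = 0 := by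
  simp [partialD]

theorem fderiv_apply_eq_sum_partialD {f : (Fin n → ℝ) → F} (a : Fin n → ℝ) :
    fderiv ℝ f u a = ∑ i, a i • partialD i f u := by
  conv_lhs => rw [pi_eq_sum_univ' a]
  rw [map_sum]
  refine Finset.sum_congr rfl fun i _ => ?_
  rw [map_smul, partialD]

theorem DifferentiableAt.det {ι : Type*} [Fintype ι] [DecidableEq ι] {M : F → Matrix ι ι ℝ} {w : F}
    (hM : ∀ i j, DifferentiableAt ℝ (fun v => M v i j) w) :
    DifferentiableAt ℝ (fun v => (M v).det) w := by
  simp only [Matrix.det_apply]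
  refine DifferentiableAt.fun_sum fun σ _ => ?_
  refine DifferentiableAt.const_smul ?_ _
  exact (HasFDerivAt.finsetProd fun i _ => (hM (σ i) i).hasFDerivAt).differentiableAt

theorem DifferentiableAt.matrix_inv {ι : Type*} [Fintype ι] [DecidableEq ι] {M : F → Matrix ι ι ℝ}
    {w : F} (hM : ∀ i j, DifferentiableAt ℝ (fun v => M v i j) w) (hdet : (M w).det ≠ 0)
    (i j : ι) : DifferentiableAt ℝ (fun v => (M v)⁻¹ i j) w := by
  simp only [Matrix.inv_def, Matrix.smul_apply, smul_eq_mul, Ring.inverse_eq_inv',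
    Matrix.adjugate_apply]
  refine ((DifferentiableAt.det hM).fun_inv hdet).fun_mul (DifferentiableAt.det fun a b => ?_)
  -- An adjugate entry is a determinant in which row `j` is replaced by a constant row.
  by_cases ha : a = j
  · subst ha
    simp
  · simpa [Matrix.updateRow_ne ha] using hM a b

end PartialDerivatives

/-! ## The Gauss equation of a centro-affine hypersurface -/

section GaussEquation

variable {n : ℕ}
  {T : (Fin (n + 1) → ℝ) →L[ℝ] (Fin (n + 1) → ℝ) →L[ℝ] (Fin (n + 1) → ℝ) →L[ℝ] ℝ}
  {V : Set (Fin n → ℝ)} {φ : (Fin n → ℝ) → (Fin (n + 1) → ℝ)}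
  {g : (Fin n → ℝ) → Matrix (Fin n) (Fin n) ℝ} {u : Fin n → ℝ}

theorem apply_partialD_eq_zero (hT1 : ∀ x y z, T x y z = T y x z)
    (hT2 : ∀ x y z, T x y z = T x z y) (hV : IsOpen V) (hφ : ContDiffOn ℝ ∞ φ V)
    (hone : ∀ v ∈ V, T (φ v) (φ v) (φ v) = 1) (hu : u ∈ V) (i : Fin n) :
    T (φ u) (φ u) (partialD i φ u) = 0 := by
  have hd := hφ.differentiableAt_of_isOpen hV hu
  have h1 := partialD_trilinear T hd hd hd i
  rw [partialD_congr hV hu hone, partialD_const, hT1 (partialD i φ u),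
    hT2 (φ u) (partialD i φ u)] at h1
  linarith

/-- Pairing the Gauss equation with `T(φ,φ,·)`, which kills tangent vectors and is 1 on `φ`,
isolates `g`. Differentiating `T(φ,φ,∂ⱼφ) = 0` evaluates the same pairing. -/
theorem centroAffineForm_eq (hT1 : ∀ x y z, T x y z = T y x z)
    (hT2 : ∀ x y z, T x y z = T x z y) (hV : IsOpen V) (hφ : ContDiffOn ℝ ∞ φ V)
    (hone : ∀ v ∈ V, T (φ v) (φ v) (φ v) = 1) (hg : IsCentroAffineForm V φ g) (hu : u ∈ V)
    (i j : Fin n) : g u i j = -2 * T (φ u) (partialD i φ u) (partialD j φ u) := by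
  have hd := hφ.differentiableAt_of_isOpen hV hu
  have htan := fun v (hv : v ∈ V) => apply_partialD_eq_zero hT1 hT2 hV hφ hone hv
  have h1 := partialD_trilinear T hd hd ((hφ.partialD hV j).differentiableAt_of_isOpen hV hu) i
  rw [partialD_congr hV hu fun v hv => htan v hv j, partialD_const, hT1 (partialD i φ u)] at h1
  obtain ⟨A, hA⟩ := hg u hu i j
  have h2 : T (φ u) (φ u) (partialD i (partialD j φ) u) = g u i j := by
    rw [hA, map_add, map_sum, map_smul, hone u hu]
    simp [htan u hu]
  linarith

/-- The Christoffel symbols of the first kind of the centro-affine fundamental form, in terms of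
the cubic form. -/
noncomputable def lowerChristoffel
    (T : (Fin (n + 1) → ℝ) →L[ℝ] (Fin (n + 1) → ℝ) →L[ℝ] (Fin (n + 1) → ℝ) →L[ℝ] ℝ)
    (φ : (Fin n → ℝ) → (Fin (n + 1) → ℝ)) (i j l : Fin n) (u : Fin n → ℝ) : ℝ :=
  -1 * T (partialD i φ u) (partialD j φ u) (partialD l φ u)
    + -2 * T (φ u) (partialD i (partialD j φ) u) (partialD l φ u)

theorem partialD_centroAffineForm (hV : IsOpen V) (hφ : ContDiffOn ℝ ∞ φ V)
    (hgT : ∀ v ∈ V, ∀ i j, g v i j = -2 * T (φ v) (partialD i φ v) (partialD j φ v)) (hu : u ∈ V)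
    (l i j : Fin n) :
    partialD l (fun v => g v i j) u =
      -2 * (T (partialD l φ u) (partialD i φ u) (partialD j φ u)
        + T (φ u) (partialD l (partialD i φ) u) (partialD j φ u)
        + T (φ u) (partialD i φ u) (partialD l (partialD j φ) u)) := by
  have hd := hφ.differentiableAt_of_isOpen hV hu
  have hd' := fun j => (hφ.partialD hV j).differentiableAt_of_isOpen hV hu
  rw [partialD_congr hV hu fun v hv => hgT v hv i j, partialD_const_mul,
    partialD_trilinear T hd (hd' i) (hd' j)]
  exact (hφ.trilinear T (hφ.partialD hV i) (hφ.partialD hV j)).differentiableAt_of_isOpen hV hu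

theorem christoffel_centroAffineForm (hT1 : ∀ x y z, T x y z = T y x z)
    (hT2 : ∀ x y z, T x y z = T x z y) (hV : IsOpen V) (hφ : ContDiffOn ℝ ∞ φ V)
    (hgT : ∀ v ∈ V, ∀ i j, g v i j = -2 * T (φ v) (partialD i φ v) (partialD j φ v)) (hu : u ∈ V)
    (k i j : Fin n) :
    christoffel g k i j u = ∑ l, (g u)⁻¹ k l * lowerChristoffel T φ i j l u := by
  rw [christoffel, Finset.mul_sum]
  refine Finset.sum_congr rfl fun l _ => ?_
  rw [mul_left_comm]
  congr 1
  simp only [partialD_centroAffineForm hV hφ hgT hu, lowerChristoffel]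
  rw [partialD_comm hφ hV hu j i, partialD_comm hφ hV hu l i, partialD_comm hφ hV hu l j,
    hT1 (partialD j φ u) (partialD i φ u), hT1 (partialD l φ u) (partialD i φ u),
    hT2 (partialD i φ u) (partialD l φ u), hT2 (φ u) (partialD j φ u),
    hT2 (φ u) (partialD i φ u)]
  ring

theorem sum_mul_christoffel (hT1 : ∀ x y z, T x y z = T y x z)
    (hT2 : ∀ x y z, T x y z = T x z y) (hV : IsOpen V) (hφ : ContDiffOn ℝ ∞ φ V)
    (hgT : ∀ v ∈ V, ∀ i j, g v i j = -2 * T (φ v) (partialD i φ v) (partialD j φ v))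
    (hdet : ∀ v ∈ V, (g v).det ≠ 0) (hu : u ∈ V) (i j l : Fin n) :
    ∑ k, g u l k * christoffel g k i j u = lowerChristoffel T φ i j l u := by
  have h1 : ∀ k, christoffel g k i j u =
      ((g u)⁻¹.mulVec fun l => lowerChristoffel T φ i j l u) k := fun k =>
    christoffel_centroAffineForm hT1 hT2 hV hφ hgT hu k i j
  have h2 := congrFun (Matrix.mulVec_mulVec (fun l => lowerChristoffel T φ i j l u) (g u) (g u)⁻¹) l
  rw [Matrix.mul_nonsing_inv _ (isUnit_iff_ne_zero.mpr (hdet u hu)), Matrix.one_mulVec] at h2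
  rw [← h2]
  simp only [h1]
  rfl

theorem contDiffOn_lowerChristoffel (hV : IsOpen V) (hφ : ContDiffOn ℝ ∞ φ V) (i j l : Fin n) :
    ContDiffOn ℝ ∞ (lowerChristoffel T φ i j l) V :=
  (contDiffOn_const.mul
    ((hφ.partialD hV i).trilinear T (hφ.partialD hV j) (hφ.partialD hV l))).add
  (contDiffOn_const.mul (hφ.trilinear T ((hφ.partialD hV j).partialD hV i) (hφ.partialD hV l)))

theorem differentiableAt_centroAffineForm (hV : IsOpen V) (hφ : ContDiffOn ℝ ∞ φ V)
    (hgT : ∀ v ∈ V, ∀ i j, g v i j = -2 * T (φ v) (partialD i φ v) (partialD j φ v)) (hu : u ∈ V)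
    (i j : Fin n) : DifferentiableAt ℝ (fun v => g v i j) u := by
  refine DifferentiableAt.congr_of_eventuallyEq ?_
    (Filter.eventuallyEq_of_mem (hV.mem_nhds hu) fun v hv => hgT v hv i j)
  exact ((hφ.trilinear T (hφ.partialD hV i)
    (hφ.partialD hV j)).differentiableAt_of_isOpen hV hu).const_mul (-2)

theorem differentiableAt_christoffel (hT1 : ∀ x y z, T x y z = T y x z)
    (hT2 : ∀ x y z, T x y z = T x z y) (hV : IsOpen V) (hφ : ContDiffOn ℝ ∞ φ V)
    (hgT : ∀ v ∈ V, ∀ i j, g v i j = -2 * T (φ v) (partialD i φ v) (partialD j φ v))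
    (hdet : ∀ v ∈ V, (g v).det ≠ 0) (hu : u ∈ V) (k i j : Fin n) :
    DifferentiableAt ℝ (christoffel g k i j) u := by
  refine DifferentiableAt.congr_of_eventuallyEq ?_ (Filter.eventuallyEq_of_mem (hV.mem_nhds hu)
    fun v hv => christoffel_centroAffineForm hT1 hT2 hV hφ hgT hv k i j)
  refine DifferentiableAt.fun_sum fun l _ => ?_
  exact (DifferentiableAt.matrix_inv (differentiableAt_centroAffineForm hV hφ hgT hu)
    (hdet u hu) k l).fun_mul
    ((contDiffOn_lowerChristoffel hV hφ i j l).differentiableAt_of_isOpen hV hu)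

theorem partialD_lowerChristoffel (hV : IsOpen V) (hφ : ContDiffOn ℝ ∞ φ V) (hu : u ∈ V)
    (i j k l : Fin n) :
    partialD i (lowerChristoffel T φ j k l) u =
      -(T (partialD i (partialD j φ) u) (partialD k φ u) (partialD l φ u)
        + T (partialD j φ u) (partialD i (partialD k φ) u) (partialD l φ u)
        + T (partialD j φ u) (partialD k φ u) (partialD i (partialD l φ) u))
      - 2 * (T (partialD i φ u) (partialD j (partialD k φ) u) (partialD l φ u)
        + T (φ u) (partialD i (partialD j (partialD k φ)) u) (partialD l φ u)
        + T (φ u) (partialD j (partialD k φ) u) (partialD i (partialD l φ) u)) := by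
  have hd := hφ.differentiableAt_of_isOpen hV hu
  have hd' := fun j => (hφ.partialD hV j).differentiableAt_of_isOpen hV hu
  have hd'' := fun j k =>
    ((hφ.partialD hV k).partialD hV j).differentiableAt_of_isOpen hV hu
  have h1 := ((hφ.partialD hV j).trilinear T (hφ.partialD hV k)
    (hφ.partialD hV l)).differentiableAt_of_isOpen hV hu
  have h2 := (hφ.trilinear T ((hφ.partialD hV k).partialD hV j)
    (hφ.partialD hV l)).differentiableAt_of_isOpen hV hu
  unfold lowerChristoffel
  rw [partialD_add (h1.const_mul _) (h2.const_mul _), partialD_const_mul h1, partialD_const_mul h2,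
    partialD_trilinear T (hd' j) (hd' k) (hd' l), partialD_trilinear T hd (hd'' j k) (hd' l)]
  ring

/-- Product rule applied to `g · Γ = lowerChristoffel`, so the derivative of the inverse metric
never has to be computed. -/
theorem sum_mul_partialD_christoffel (hT1 : ∀ x y z, T x y z = T y x z)
    (hT2 : ∀ x y z, T x y z = T x z y) (hV : IsOpen V) (hφ : ContDiffOn ℝ ∞ φ V)
    (hgT : ∀ v ∈ V, ∀ i j, g v i j = -2 * T (φ v) (partialD i φ v) (partialD j φ v))
    (hdet : ∀ v ∈ V, (g v).det ≠ 0) (hu : u ∈ V) (i j k l : Fin n) :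
    ∑ m, g u l m * partialD i (christoffel g m j k) u =
      partialD i (lowerChristoffel T φ j k l) u
        - ∑ m, partialD i (fun v => g v l m) u * christoffel g m j k u := by
  have hΓ := fun m => differentiableAt_christoffel hT1 hT2 hV hφ hgT hdet hu m j k
  have hgd := fun m => differentiableAt_centroAffineForm hV hφ hgT hu l m
  have h1 := partialD_congr hV hu
    (fun v hv => sum_mul_christoffel hT1 hT2 hV hφ hgT hdet hv j k l) i
  rw [partialD_sum (fun m => (hgd m).fun_mul (hΓ m))] at h1
  have h2 : partialD i (lowerChristoffel T φ j k l) u =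
    partialD i (fun v => lowerChristoffel T φ j k l v) u := rfl
  rw [h2, ← h1, ← Finset.sum_sub_distrib]
  refine Finset.sum_congr rfl fun m _ => ?_
  rw [partialD_mul (hgd m) (hΓ m)]
  ring

/-- If `∂ᵢ∂ⱼφ = Wᵢⱼ + Kᵢⱼ + gᵢⱼ φ` with `Wᵢⱼ` the tangential part given by the Levi-Civita
connection, then the lowered Riemann tensor is determined by `g` and `K`. -/
theorem sum_mul_riemann (hT1 : ∀ x y z, T x y z = T y x z)
    (hT2 : ∀ x y z, T x y z = T x z y) (hV : IsOpen V) (hφ : ContDiffOn ℝ ∞ φ V)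
    (hone : ∀ v ∈ V, T (φ v) (φ v) (φ v) = 1) (hg : IsCentroAffineForm V φ g)
    (hdet : ∀ v ∈ V, (g v).det ≠ 0) (hu : u ∈ V) :
    ∃ K : Fin n → Fin n → Fin n → ℝ,
      (∀ i j l, ∑ m, g u m l * K m i j =
        T (partialD i φ u) (partialD j φ u) (partialD l φ u)) ∧
      ∀ l k i j, ∑ m, g u l m * riemann g m k i j u =
        ∑ a, ∑ b, g u a b * (K a i k * K b j l) - ∑ a, ∑ b, g u a b * (K a i l * K b j k)
          + g u i k * g u j l - g u i l * g u j k := by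
  have hgT := fun v (hv : v ∈ V) => centroAffineForm_eq hT1 hT2 hV hφ hone hg hv
  have htan := apply_partialD_eq_zero hT1 hT2 hV hφ hone hu
  have hΓ := sum_mul_christoffel hT1 hT2 hV hφ hgT hdet hu
  choose A hA using hg u hu
  let W : Fin n → Fin n → Fin (n + 1) → ℝ := fun i j => ∑ m, christoffel g m i j u • partialD m φ u
  let K : Fin n → Fin n → Fin n → ℝ := fun m i j => A i j m - christoffel g m i j u
  let S : Fin n → Fin n → Fin (n + 1) → ℝ := fun i j => ∑ m, K m i j • partialD m φ u
  have hdec : ∀ i j, partialD i (partialD j φ) u = W i j + S i j + g u i j • φ u := by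
    intro i j
    rw [hA, ← Finset.sum_add_distrib]
    congr 1
    refine Finset.sum_congr rfl fun m _ => ?_
    rw [← add_smul]
    congr 1
    simp [K]
  have hW0 : ∀ i j, T (φ u) (φ u) (W i j) = 0 := by
    intro i j
    simp [W, map_sum, htan]
  have hS0 : ∀ i j, T (φ u) (φ u) (S i j) = 0 := by
    intro i j
    simp [S, map_sum, htan]
  have hWF : ∀ i j l, -2 * T (φ u) (partialD l φ u) (W i j) = lowerChristoffel T φ i j l u := by
    intro i j l
    rw [← hΓ i j l]
    simp only [W, map_sum, map_smul, smul_eq_mul, Finset.mul_sum, hgT u hu]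
    exact Finset.sum_congr rfl fun m _ => by ring
  -- The difference tensor `K` is thus `T` with an index raised, hence totally symmetric once
  -- lowered.
  have hS : ∀ i j l, -2 * T (φ u) (S i j) (partialD l φ u) =
      T (partialD i φ u) (partialD j φ u) (partialD l φ u) := by
    intro i j l
    have h1 := hWF i j l
    rw [lowerChristoffel, hdec, hT2 (φ u) (partialD l φ u)] at h1
    simp only [map_add, map_smul, add_apply, smul_apply, smul_eq_mul, htan] at h1
    linarith
  have hSW : ∀ i l j k, T (partialD i φ u) (partialD l φ u) (W j k) =
      -2 * T (φ u) (S i l) (W j k) := by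
    intro i l j k
    simp only [W, map_sum, map_smul, smul_eq_mul, Finset.mul_sum, ← hS]
    exact Finset.sum_congr rfl fun m _ => by ring
  have hSS : ∀ i l j k, T (partialD i φ u) (partialD l φ u) (S j k) =
      -2 * T (φ u) (S i l) (S j k) := by
    intro i l j k
    simp only [S, map_sum (T (partialD i φ u) (partialD l φ u)), map_smul, smul_eq_mul, ← hS,
      map_sum (T (φ u) _), Finset.mul_sum]
    exact Finset.sum_congr rfl fun m _ => by ring
  have hSK : ∀ i j k l, -2 * T (φ u) (S i j) (S k l) =
      ∑ a, ∑ b, g u a b * (K a i j * K b k l) := by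
    intro i j k l
    simp only [S, map_sum, map_smul, smul_eq_mul, Finset.mul_sum, hgT u hu, sum_apply, smul_apply]
    rw [Finset.sum_comm]
    exact Finset.sum_congr rfl fun a _ => Finset.sum_congr rfl fun b _ => by ring
  have hR : ∀ i j k l, ∑ m, g u l m * (partialD i (christoffel g m j k) u
      + ∑ q, christoffel g m i q u * christoffel g q j k u) =
      partialD i (lowerChristoffel T φ j k l) u + 2 * T (φ u) (W i l) (W j k) := by
    intro i j k l
    -- The terms in `X` from `∂g · Γ` and from `Γ · Γ` cancel.
    let X := ∑ m, christoffel g m j k u • partialD i (partialD m φ) u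
    have h1 : ∑ m, partialD i (fun v => g v l m) u * christoffel g m j k u =
        -2 * (T (partialD i φ u) (partialD l φ u) (W j k)
          + T (φ u) (partialD i (partialD l φ) u) (W j k) + T (φ u) (partialD l φ u) X) := by
      simp only [W, X, map_sum, map_smul, smul_eq_mul, ← Finset.sum_add_distrib, Finset.mul_sum,
        partialD_centroAffineForm hV hφ hgT hu]
      exact Finset.sum_congr rfl fun m _ => by ring
    have h2 : ∑ m, g u l m * ∑ q, christoffel g m i q u * christoffel g q j k u =
        -T (partialD i φ u) (partialD l φ u) (W j k) - 2 * T (φ u) (partialD l φ u) X := by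
      simp only [Finset.mul_sum]
      rw [Finset.sum_comm]
      have h3 : ∀ q, ∑ m, g u l m * (christoffel g m i q u * christoffel g q j k u) =
          lowerChristoffel T φ i q l u * christoffel g q j k u := by
        intro q
        rw [← hΓ, Finset.sum_mul]
        exact Finset.sum_congr rfl fun m _ => by ring
      simp only [h3, W, X, map_sum, map_smul, smul_eq_mul, ← Finset.sum_sub_distrib,
        Finset.mul_sum, ← Finset.sum_neg_distrib, lowerChristoffel]
      refine Finset.sum_congr rfl fun m _ => ?_
      rw [hT2 (partialD i φ u) (partialD m φ u), hT2 (φ u) (partialD l φ u)]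
      ring
    simp only [mul_add, Finset.sum_add_distrib]
    rw [sum_mul_partialD_christoffel hT1 hT2 hV hφ hgT hdet hu, h1, h2, hdec i l, hSW]
    simp only [map_add, map_smul, add_apply, smul_apply, smul_eq_mul, hW0]
    ring
  have hE : ∀ i l j k, T (partialD i φ u) (partialD l φ u) (partialD j (partialD k φ) u) =
      -2 * T (φ u) (S i l) (W j k) - 2 * T (φ u) (S i l) (S j k)
        - 1 / 2 * (g u i l * g u j k) := by
    intro i l j k
    rw [hdec, map_add, map_add, map_smul, hSW, hSS, hT2 _ _ (φ u), hT1 _ (φ u), hgT u hu i l,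
      smul_eq_mul]
    ring
  have hEE : ∀ i l j k, T (φ u) (partialD i (partialD l φ) u) (partialD j (partialD k φ) u) =
      T (φ u) (W i l) (W j k) + T (φ u) (W i l) (S j k) + T (φ u) (S i l) (W j k)
        + T (φ u) (S i l) (S j k) + g u i l * g u j k := by
    intro i l j k
    rw [hdec, hdec]
    simp only [map_add, map_smul, add_apply, smul_apply, smul_eq_mul, hW0, hS0, hone u hu,
      hT2 (φ u) (W i l) (φ u), hT2 (φ u) (S i l) (φ u)]
    ring
  refine ⟨K, ?_, ?_⟩
  · intro i j l
    rw [← hS]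
    simp only [S, map_sum, map_smul, smul_eq_mul, Finset.mul_sum, hgT u hu, sum_apply, smul_apply]
    exact Finset.sum_congr rfl fun m _ => by ring
  · intro l k i j
    have h1 : ∑ m, g u l m * riemann g m k i j u =
        ∑ m, g u l m * (partialD i (christoffel g m j k) u
          + ∑ q, christoffel g m i q u * christoffel g q j k u) -
        ∑ m, g u l m * (partialD j (christoffel g m i k) u
          + ∑ q, christoffel g m j q u * christoffel g q i k u) := by
      rw [← Finset.sum_sub_distrib]
      refine Finset.sum_congr rfl fun m _ => ?_
      rw [riemann, Finset.sum_sub_distrib]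
      ring
    -- Third derivatives of `φ` drop out on antisymmetrising in `i` and `j`.
    have h3 := partialD_comm (hφ.partialD hV k) hV hu i j
    rw [h1, hR, hR, partialD_lowerChristoffel hV hφ hu, partialD_lowerChristoffel hV hφ hu, h3,
      partialD_comm hφ hV hu j i, ← hSK, ← hSK,
      hT2 (partialD j φ u) (partialD i (partialD k φ) u),
      hT2 (partialD i φ u) (partialD j (partialD k φ) u)]
    simp only [hE, hEE]
    rw [hT2 (φ u) (W j l) (W i k), hT2 (φ u) (S j l) (W i k), hT2 (φ u) (S j l) (S i k),
      hT2 (φ u) (W j k) (S i l),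
      hT2 (φ u) (W j k) (W i l), hT2 (φ u) (S j k) (W i l), hT2 (φ u) (S j k) (S i l)]
    ring

end GaussEquation

/-! ## Curvature bounds -/

section CurvatureBounds

variable {n : ℕ}

/-- The bilinear product on `ℝⁿ` with structure constants `K`. -/
noncomputable def structureProduct (K : Fin n → Fin n → Fin n → ℝ) :
    (Fin n → ℝ) →ₗ[ℝ] (Fin n → ℝ) →ₗ[ℝ] (Fin n → ℝ) :=
  LinearMap.mk₂ ℝ (fun a b l => ∑ i, ∑ j, K l i j * (a i * b j))
    (fun a a' b => by
      ext l
      simp [add_mul, mul_add, Finset.sum_add_distrib])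
    (fun c a b => by
      ext l
      simp only [Pi.smul_apply, smul_eq_mul, Finset.mul_sum]
      exact Finset.sum_congr rfl fun i _ => Finset.sum_congr rfl fun j _ => by ring)
    (fun a b b' => by
      ext l
      simp [mul_add, Finset.sum_add_distrib])
    (fun c a b => by
      ext l
      simp only [Pi.smul_apply, smul_eq_mul, Finset.mul_sum]
      exact Finset.sum_congr rfl fun i _ => Finset.sum_congr rfl fun j _ => by ring)

theorem structureProduct_apply (K : Fin n → Fin n → Fin n → ℝ) (a b : Fin n → ℝ) (l : Fin n) :
    structureProduct K a b l = ∑ i, ∑ j, K l i j * (a i * b j) := rfl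

theorem metricInner_eq_toBilin' (g : (Fin n → ℝ) → Matrix (Fin n) (Fin n) ℝ) (u a b : Fin n → ℝ) :
    metricInner g u a b = Matrix.toBilin' (g u) a b := by
  rw [Matrix.toBilin'_apply, metricInner]
  exact Finset.sum_congr rfl fun i _ => Finset.sum_congr rfl fun j _ => by ring

theorem structureProduct_eq_sum (K : Fin n → Fin n → Fin n → ℝ) (a b : Fin n → ℝ) :
    structureProduct K a b = ∑ i, ∑ k, (a i * b k) • fun l => K l i k := by
  ext l
  simp only [structureProduct_apply, Finset.sum_apply, Pi.smul_apply, smul_eq_mul]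
  exact Finset.sum_congr rfl fun i _ => Finset.sum_congr rfl fun k _ => mul_comm _ _

theorem toBilin'_structureProduct (G : Matrix (Fin n) (Fin n) ℝ) (K : Fin n → Fin n → Fin n → ℝ)
    (a b c d : Fin n → ℝ) :
    Matrix.toBilin' G (structureProduct K a b) (structureProduct K c d) =
      ∑ i, ∑ k, ∑ j, ∑ l,
        a i * b k * c j * d l * ∑ p, ∑ q, G p q * (K p i k * K q j l) := by
  rw [structureProduct_eq_sum K a b]
  simp only [map_sum, LinearMap.sum_apply, map_smul, LinearMap.smul_apply, smul_eq_mul]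
  refine Finset.sum_congr rfl fun i _ => Finset.sum_congr rfl fun k _ => ?_
  rw [structureProduct_eq_sum K c d]
  simp only [map_sum, map_smul, smul_eq_mul]
  rw [Finset.mul_sum]
  refine Finset.sum_congr rfl fun j _ => ?_
  rw [Finset.mul_sum]
  refine Finset.sum_congr rfl fun l _ => ?_
  rw [← mul_assoc, ← mul_assoc, Matrix.toBilin'_apply]
  congr 1
  exact Finset.sum_congr rfl fun p _ => Finset.sum_congr rfl fun q _ => by ring

theorem toBilin'_mul_toBilin' (G : Matrix (Fin n) (Fin n) ℝ) (a b c d : Fin n → ℝ) :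
    Matrix.toBilin' G a b * Matrix.toBilin' G c d =
      ∑ i, ∑ k, ∑ j, ∑ l, a i * b k * c j * d l * (G i k * G j l) := by
  rw [Matrix.toBilin'_apply, Matrix.toBilin'_apply, Finset.sum_mul]
  refine Finset.sum_congr rfl fun i _ => ?_
  rw [Finset.sum_mul]
  refine Finset.sum_congr rfl fun k _ => ?_
  rw [Finset.mul_sum]
  refine Finset.sum_congr rfl fun j _ => ?_
  rw [Finset.mul_sum]
  exact Finset.sum_congr rfl fun l _ => by ring

theorem sum_comm_reverse {ι : Type*} [Fintype ι] (f : ι → ι → ι → ℝ) :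
    ∑ k, ∑ j, ∑ l, f k j l = ∑ l, ∑ j, ∑ k, f k j l := by
  rw [Finset.sum_comm, Finset.sum_congr rfl fun j _ => Finset.sum_comm, Finset.sum_comm]

variable {g : (Fin n → ℝ) → Matrix (Fin n) (Fin n) ℝ} {u : Fin n → ℝ}
  {K : Fin n → Fin n → Fin n → ℝ}

theorem metricInner_riemannVec (hsymm : ∀ i j, g u i j = g u j i) (a b : Fin n → ℝ) :
    metricInner g u (riemannVec g u a b b) a =
      ∑ i, ∑ l, ∑ j, ∑ k, a i * a l * b j * b k * ∑ m, g u l m * riemann g m k i j u := by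
  have h1 : metricInner g u (riemannVec g u a b b) a = ∑ l, ∑ m, ∑ i, ∑ j, ∑ k,
      a i * a l * b j * b k * (g u l m * riemann g m k i j u) := by
    rw [metricInner, Finset.sum_comm]
    refine Finset.sum_congr rfl fun l _ => Finset.sum_congr rfl fun m _ => ?_
    rw [riemannVec, hsymm m l, mul_assoc, Finset.sum_mul, Finset.mul_sum]
    refine Finset.sum_congr rfl fun i _ => ?_
    rw [Finset.sum_mul, Finset.mul_sum]
    refine Finset.sum_congr rfl fun j _ => ?_
    rw [Finset.sum_mul, Finset.mul_sum]
    exact Finset.sum_congr rfl fun k _ => by ring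
  rw [h1, Finset.sum_comm (γ := Fin n) (s := Finset.univ) (t := Finset.univ)
    (f := fun i l => ∑ j, ∑ k, a i * a l * b j * b k * ∑ m, g u l m * riemann g m k i j u)]
  refine Finset.sum_congr rfl fun l _ => ?_
  rw [Finset.sum_comm]
  refine Finset.sum_congr rfl fun i _ => ?_
  rw [Finset.sum_comm]
  refine Finset.sum_congr rfl fun j _ => ?_
  rw [Finset.sum_comm]
  refine Finset.sum_congr rfl fun k _ => ?_
  rw [Finset.mul_sum]

theorem metricInner_riemannVec_eq (hsymm : ∀ i j, g u i j = g u j i)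
    (hR : ∀ l k i j, ∑ m, g u l m * riemann g m k i j u =
        ∑ a, ∑ b, g u a b * (K a i k * K b j l) - ∑ a, ∑ b, g u a b * (K a i l * K b j k)
          + g u i k * g u j l - g u i l * g u j k) (a b : Fin n → ℝ) :
    metricInner g u (riemannVec g u a b b) a =
      Matrix.toBilin' (g u) (structureProduct K a b) (structureProduct K b a)
        - Matrix.toBilin' (g u) (structureProduct K a a) (structureProduct K b b)
        + Matrix.toBilin' (g u) a b * Matrix.toBilin' (g u) b a
        - Matrix.toBilin' (g u) a a * Matrix.toBilin' (g u) b b := by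
  rw [metricInner_riemannVec hsymm, toBilin'_structureProduct (g u) K a b b a,
    toBilin'_structureProduct, toBilin'_mul_toBilin' (g u) a b b a, toBilin'_mul_toBilin',
    Finset.sum_congr rfl fun i _ => sum_comm_reverse fun k j l =>
      a i * b k * b j * a l * ∑ p, ∑ q, g u p q * (K p i k * K q j l),
    Finset.sum_congr rfl fun i _ => sum_comm_reverse fun k j l =>
      a i * b k * b j * a l * (g u i k * g u j l)]
  simp only [← Finset.sum_sub_distrib, ← Finset.sum_add_distrib]
  refine Finset.sum_congr rfl fun i _ => Finset.sum_congr rfl fun l _ =>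
    Finset.sum_congr rfl fun j _ => Finset.sum_congr rfl fun k _ => ?_
  rw [hR]
  ring

/-- Writing the inverse metric as `∑ₛ M s j * M s k` turns both traces into sums over the rows of
`M`, which form an orthonormal basis. -/
theorem scalarCurvature_eq_sum (hsymm : ∀ i j, g u i j = g u j i) (hdet : (g u).det ≠ 0)
    {M : Matrix (Fin n) (Fin n) ℝ} (hM : (g u)⁻¹ = M.transpose * M) :
    scalarCurvature g u =
      ∑ s, ∑ t, metricInner g u (riemannVec g u (M t) (M s) (M s)) (M t) := by
  have hinv : ∀ j k, (g u)⁻¹ j k = ∑ s, M s j * M s k := by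
    intro j k
    rw [hM, Matrix.mul_apply]
    rfl
  have hriem : ∀ i k j, riemann g i k i j u =
      ∑ l, (g u)⁻¹ i l * ∑ m, g u l m * riemann g m k i j u := by
    intro i k j
    have h2 := congrFun
      (Matrix.mulVec_mulVec (fun m => riemann g m k i j u) (g u)⁻¹ (g u)) i
    rw [Matrix.nonsing_inv_mul _ (isUnit_iff_ne_zero.mpr hdet), Matrix.one_mulVec] at h2
    exact h2.symm
  have h1 : scalarCurvature g u = ∑ j, ∑ k, ∑ i, ∑ l, ∑ s, ∑ t,
      M t i * M t l * M s j * M s k * ∑ m, g u l m * riemann g m k i j u := by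
    rw [scalarCurvature]
    refine Finset.sum_congr rfl fun j _ => Finset.sum_congr rfl fun k _ => ?_
    rw [ricci, Finset.mul_sum]
    refine Finset.sum_congr rfl fun i _ => ?_
    rw [hriem, Finset.mul_sum]
    refine Finset.sum_congr rfl fun l _ => ?_
    rw [hinv, hinv, Finset.sum_mul]
    refine Finset.sum_congr rfl fun s _ => ?_
    rw [Finset.sum_mul, Finset.mul_sum]
    exact Finset.sum_congr rfl fun t _ => by ring
  have h2 : ∀ F : Fin n → Fin n → Fin n → Fin n → Fin n → Fin n → ℝ,
      ∑ s, ∑ t, ∑ i, ∑ l, ∑ j, ∑ k, F s t i l j k =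
        ∑ j, ∑ k, ∑ i, ∑ l, ∑ s, ∑ t, F s t i l j k := by
    intro F
    simp only [← Fintype.sum_prod_type']
    let e : Fin n × Fin n × Fin n × Fin n × Fin n × Fin n ≃
        Fin n × Fin n × Fin n × Fin n × Fin n × Fin n :=
      { toFun := fun x => (x.2.2.2.2.1, x.2.2.2.2.2, x.2.2.1, x.2.2.2.1, x.1, x.2.1)
        invFun := fun x => (x.2.2.2.2.1, x.2.2.2.2.2, x.2.2.1, x.2.2.2.1, x.1, x.2.1)
        left_inv := fun _ => rfl
        right_inv := fun _ => rfl }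
    exact Fintype.sum_equiv e _ _ fun _ => rfl
  rw [h1]
  simp only [metricInner_riemannVec hsymm]
  exact (h2 _).symm

end CurvatureBounds

/-! ## Curvature of CCPSR manifolds -/

section CCPSR

open scoped MatrixOrder Matrix.Norms.L2Operator in
theorem Matrix.PosDef.exists_inv_eq_transpose_mul {ι : Type*} [Fintype ι] [DecidableEq ι]
    {A : Matrix ι ι ℝ} (hA : A.PosDef) : ∃ M : Matrix ι ι ℝ, A⁻¹ = M.transpose * M := by
  obtain ⟨M, hM⟩ := CStarAlgebra.nonneg_iff_eq_star_mul_self.mp hA.inv.posSemidef.nonneg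
  exact ⟨M, by rw [hM, Matrix.star_eq_conjTranspose, Matrix.conjTranspose_eq_transpose_of_trivial]⟩

/-- `MᵀMA = 1` forces `MAMᵀ = 1`, since one-sided inverses of square matrices are two-sided; read
off a diagonal entry. -/
theorem Matrix.toBilin'_row_self {ι : Type*} [Fintype ι] [DecidableEq ι] {A M : Matrix ι ι ℝ}
    (hA : A.det ≠ 0) (hM : A⁻¹ = M.transpose * M) (s : ι) : Matrix.toBilin' A (M s) (M s) = 1 := by
  have h1 : M.transpose * (M * A) = 1 := by
    rw [← Matrix.mul_assoc, ← hM, Matrix.nonsing_inv_mul _ (isUnit_iff_ne_zero.mpr hA)]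
  have h2 : (M * (A * M.transpose)) s s = 1 := by
    rw [← Matrix.mul_assoc, mul_eq_one_comm.mp h1, Matrix.one_apply_eq]
  rw [Matrix.toBilin'_apply', ← h2]
  rfl

variable {n : ℕ} {φ : (Fin n → ℝ) → (Fin (n + 1) → ℝ)}
  {g : (Fin n → ℝ) → Matrix (Fin n) (Fin n) ℝ} {u : Fin n → ℝ}

/-- The curvature `g(R(a, b)b, a)` of a CCPSR manifold is bounded by the squared area of the
parallelogram spanned by `a` and `b`. -/
theorem IsCCPSR.curvature_bound {H : Set (Fin (n + 1) → ℝ)} {V : Set (Fin n → ℝ)}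
    (hH : IsCCPSR n H) (hφ : IsLocalParametrization H V φ) (hg : IsCentroAffineForm V φ g)
    (hu : u ∈ V) :
    (g u).PosDef ∧ ∀ a b, |metricInner g u (riemannVec g u a b b) a| ≤
      33 * (metricInner g u a a * metricInner g u b b - metricInner g u a b ^ 2) := by
  obtain ⟨hcl, -, h, hh, ⟨O, hO, hHO⟩, hyp⟩ := hH
  have hT1 := cubicForm_swap h
  have hT2 := cubicForm_swap' h
  have hone : ∀ v ∈ V, cubicForm h (φ v) (φ v) (φ v) = 1 := by
    intro v hv
    have := hφ.mapsTo hv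
    rw [hHO] at this
    rw [cubicForm_self hh]
    exact this.2
  have hgT := fun v (hv : v ∈ V) =>
    centroAffineForm_eq hT1 hT2 hφ.isOpen hφ.smooth hone hg hv
  have htan : ∀ v ∈ V, ∀ a, cubicForm h (φ v) (φ v) (fderiv ℝ φ v a) = 0 := by
    intro v hv a
    rw [fderiv_apply_eq_sum_partialD, map_sum]
    simp [apply_partialD_eq_zero hT1 hT2 hφ.isOpen hφ.smooth hone hv]
  have hB : ∀ v ∈ V, ∀ a b, Matrix.toBilin' (g v) a b =
      -2 * cubicForm h (φ v) (fderiv ℝ φ v a) (fderiv ℝ φ v b) := by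
    intro v hv a b
    simp only [fderiv_apply_eq_sum_partialD, Matrix.toBilin'_apply, hgT v hv, map_sum, map_smul,
      sum_apply, smul_apply, smul_eq_mul, Finset.mul_sum]
    rw [Finset.sum_comm]
    exact Finset.sum_congr rfl fun i _ => Finset.sum_congr rfl fun j _ => by ring
  have hpos : ∀ v ∈ V, ∀ a, a ≠ 0 → 0 < Matrix.toBilin' (g v) a a := by
    intro v hv a ha
    have hne : fderiv ℝ φ v a ≠ 0 := fun h0 =>
      ha (hφ.immersion v hv (h0.trans (map_zero _).symm))
    have := (hyp _ (hφ.mapsTo hv)).cubicForm_neg hh hne (htan v hv a)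
    rw [hB v hv]
    linarith
  have hgsymm : ∀ v ∈ V, ∀ i j, g v i j = g v j i := by
    intro v hv i j
    rw [hgT v hv, hgT v hv, hT2]
  have hPD : ∀ v ∈ V, (g v).PosDef := by
    intro v hv
    refine Matrix.PosDef.of_dotProduct_mulVec_pos ?_ fun x hx => ?_
    · ext i j
      simp [hgsymm v hv j i]
    · have := hpos v hv x hx
      rw [Matrix.toBilin'_apply'] at this
      simpa using this
  have hdet : ∀ v ∈ V, (g v).det ≠ 0 := fun v hv => (hPD v hv).det_pos.ne'
  refine ⟨hPD u hu, ?_⟩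
  obtain ⟨K, hK, hR⟩ := sum_mul_riemann hT1 hT2 hφ.isOpen hφ.smooth hone hg hdet hu
  have hsymm : ∀ a b, Matrix.toBilin' (g u) a b = Matrix.toBilin' (g u) b a := by
    intro a b
    rw [hB u hu, hB u hu, hT2]
  have hKT : ∀ a b c, Matrix.toBilin' (g u) (structureProduct K a b) c =
      cubicForm h (fderiv ℝ φ u a) (fderiv ℝ φ u b) (fderiv ℝ φ u c) := by
    intro a b c
    rw [structureProduct_eq_sum, fderiv_apply_eq_sum_partialD a]
    simp only [map_sum, LinearMap.sum_apply, map_smul, LinearMap.smul_apply, smul_eq_mul,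
      sum_apply, smul_apply]
    refine Finset.sum_congr rfl fun i _ => ?_
    rw [fderiv_apply_eq_sum_partialD b]
    simp only [map_sum, map_smul, smul_eq_mul, sum_apply, smul_apply]
    rw [Finset.mul_sum]
    refine Finset.sum_congr rfl fun j _ => ?_
    rw [fderiv_apply_eq_sum_partialD c, Matrix.toBilin'_apply, Finset.sum_comm, mul_assoc]
    simp only [map_sum, map_smul, smul_eq_mul, ← hK, Finset.mul_sum]
    exact Finset.sum_congr rfl fun l _ => Finset.sum_congr rfl fun m _ => by ring
  -- By nondegeneracy of `g`, symmetry of the lowered tensor passes to `K`.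
  have hk1 : ∀ a b, structureProduct K a b = structureProduct K b a := by
    intro a b
    by_contra hne
    have h1 := hpos u hu _ (sub_ne_zero.mpr hne)
    have h0 : ∀ w, Matrix.toBilin' (g u) (structureProduct K a b - structureProduct K b a) w = 0 := by
      intro w
      rw [map_sub, LinearMap.sub_apply, hKT, hKT, hT1, sub_self]
    exact h1.ne' (h0 _)
  have hk2 : ∀ a b c, Matrix.toBilin' (g u) (structureProduct K a b) c =
      Matrix.toBilin' (g u) (structureProduct K a c) b := by
    intro a b c
    rw [hKT, hKT, hT2]
  have hk : ∀ v, Matrix.toBilin' (g u) (structureProduct K v v) v ^ 2 ≤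
      Matrix.toBilin' (g u) v v ^ 3 / 2 := by
    intro v
    rw [hKT, hB u hu]
    exact cubicForm_sq_le hcl hh hO hHO hyp (hφ.mapsTo hu) (htan u hu v)
  intro a b
  have key := abs_apply_apply_le_gram (hpos u hu) hsymm hk1 hk2 hk a b
  rw [metricInner_riemannVec_eq (hgsymm u hu) hR, hk1 b a, hsymm b a]
  simp only [metricInner_eq_toBilin']
  -- The Gram determinant is nonnegative. The constant curvature `-1` part subtracts it once, hence
  -- `33 = 32 + 1`.
  have hgram := le_trans (abs_nonneg _) key
  rw [abs_le] at key ⊢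
  constructor <;> linarith [key.1, key.2]

theorem IsSectionalCurvatureAt.abs_le {H : Set (Fin (n + 1) → ℝ)} (hH : IsCCPSR n H)
    {p : Fin (n + 1) → ℝ} {κ : ℝ} (hκ : IsSectionalCurvatureAt H p κ) : |κ| ≤ 33 := by
  obtain ⟨V, φ, g, u, a, b, hφ, hg, hu, -, -, rfl⟩ := hκ
  have h1 := (hH.curvature_bound hφ hg hu).2 a b
  rw [sectionalCurvature, abs_div]
  refine div_le_of_le_mul₀ (abs_nonneg _) (by norm_num) (h1.trans ?_)
  exact mul_le_mul_of_nonneg_left (le_abs_self _) (by norm_num)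

theorem IsScalarCurvatureAt.abs_le {H : Set (Fin (n + 1) → ℝ)} (hH : IsCCPSR n H)
    {p : Fin (n + 1) → ℝ} {s : ℝ} (hs : IsScalarCurvatureAt H p s) : |s| ≤ n * (n * 33) := by
  obtain ⟨V, φ, g, u, hφ, hg, hu, -, rfl⟩ := hs
  obtain ⟨hPD, hbound⟩ := hH.curvature_bound hφ hg hu
  obtain ⟨M, hM⟩ := hPD.exists_inv_eq_transpose_mul
  have hdet := hPD.det_pos.ne'
  have hsymm : ∀ i j, g u i j = g u j i := fun i j => by simpa using hPD.isHermitian.apply j i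
  rw [scalarCurvature_eq_sum hsymm hdet hM]
  have h1 : ∀ s t, |metricInner g u (riemannVec g u (M t) (M s) (M s)) (M t)| ≤ 33 := by
    intro s t
    refine (hbound _ _).trans ?_
    simp only [metricInner_eq_toBilin', Matrix.toBilin'_row_self hdet hM]
    -- For unit vectors the Gram determinant is at most 1; this also covers the diagonal terms `s =
    -- t`.
    nlinarith [sq_nonneg (Matrix.toBilin' (g u) (M t) (M s))]
  have h2 : ∀ f : Fin n → ℝ, ∀ c, (∀ i, |f i| ≤ c) → |∑ i, f i| ≤ n * c := fun f c hf =>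
    (Finset.abs_sum_le_sum_abs _ _).trans
      ((Finset.sum_le_card_nsmul Finset.univ _ c fun i _ => hf i).trans (by simp))
  exact h2 _ _ fun s => h2 _ _ fun t => h1 s t

end CCPSR

theorem mainTheorem5 (n : ℕ) (hn : 2 ≤ n) :
    ∃ l u l' u' : ℝ, ∀ H : Set (Fin (n + 1) → ℝ), IsCCPSR n H → ∀ p ∈ H,
      (∀ s : ℝ, IsScalarCurvatureAt H p s → l ≤ s ∧ s ≤ u) ∧
      (∀ κ : ℝ, IsSectionalCurvatureAt H p κ → l' ≤ κ ∧ κ ≤ u') := by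
  refine ⟨-(n * (n * 33)), n * (n * 33), -33, 33, fun H hH p _ => ⟨fun s hs => ?_, fun κ hκ => ?_⟩⟩
  · exact abs_le.mp (hs.abs_le hH)
  · exact abs_le.mp (hκ.abs_le hH)
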